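/- Let $n \ge 1$ and $d \ge 2$, and let $\mathcal G$ be a directed graph with node set $\{1,\dots,n\}$. Let $\mathcal A(\mathcal G)$ be the set of real $n\times n$ matrices $A=[a_{ij}]$ with non-negative entries such that, for $i\ne j$, $a_{ij}>0$ if and only if $(i,j)$ is an edge of $\mathcal G$, and such that $a_{ii}>\sum_{j\neq i}a_{ij}$ for every $i$ (the strictly diagonally dominant weight matrices for $\mathcal G$). Identify $(\mathbb S^{d-1})^n$ with the set of matrices $X\in\mathbb R^{n\times d}$ all of whose rows $x_1,\dots,x_n$ have Euclidean norm $1$. For $A\in\mathcal A(\mathcal G)$ let $\mathcal F(A)\subset(\mathbb S^{d-1})^n$ be the set of fixed points of the algorithm $$x_i(k+1)=\frac{\sum_{j=1}^n a_{ij}x_j(k)}{\big\|\sum_{j=1}^n a_{ij}x_j(k)\big\|_2},\qquad i=1,\dots,n,$$ and let $\tilde{\mathcal C}=\{X\in(\mathbb S^{d-1})^n:\operatorname{rank}X=1\}$ (the configurations in which any two $x_i,x_j$ are equal or antipodal). Suppose that at least one of the following holds: 1. $d=2$ and $\mathcal G$ is strongly connected (there is a directed path from every node to every node); 2. $d\ge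 2$ and $\mathcal G$ is complete (every $(i,j)$ with $i\ne j$ is an edge). Then the set of $A\in\mathcal A(\mathcal G)$ for which $\mathcal F(A)\neq\tilde{\mathcal C}$ has measure zero in $\mathcal A(\mathcal G)$; here $\mathcal A(\mathcal G)$, which is a relatively open subset of the linear space of matrices $A$ with $a_{ij}=0$ whenever $i\neq j$ and $(i,j)$ is not an edge, carries the Lebesgue measure of that space in the coordinates $a_{ii}$ ($1\le i\le n$) and $a_{ij}$ ($i\ne j$, $(i,j)$ an edge). -/

import Mathlib

open scoped Matrix

namespace SphereConsensus

/-- A directed graph is strongly connected if there is a directed path from any node to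
any node. -/
def StronglyConnected {n : ℕ} (G : Digraph (Fin n)) : Prop :=
  ∀ i j : Fin n, Relation.ReflTransGen G.Adj i j

/-- A directed graph is complete if there is an edge from every node to every other node
(self-loops are irrelevant for weight matrices). -/
def IsComplete {n : ℕ} (G : Digraph (Fin n)) : Prop :=
  ∀ i j : Fin n, i ≠ j → G.Adj i j

/-- `A` is a weight matrix for `G`: its entries are non-negative, and an off-diagonal entry is
positive exactly when it corresponds to an edge of `G`. -/
def IsWeightMatrix {n : ℕ} (G : Digraph (Fin n)) (A : Matrix (Fin n) (Fin n) ℝ) : Prop :=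
  (∀ i j, 0 ≤ A i j) ∧ ∀ i j, i ≠ j → (0 < A i j ↔ G.Adj i j)

/-- Strict diagonal dominance: each diagonal entry is larger than the sum of the other entries
in its row. -/
def StrictlyDiagDominant {n : ℕ} (A : Matrix (Fin n) (Fin n) ℝ) : Prop :=
  ∀ i, ∑ j ∈ Finset.univ.erase i, A i j < A i i

/-- The set of strictly diagonally dominant weight matrices for `G`. -/
def weightMatrices {n : ℕ} (G : Digraph (Fin n)) : Set (Matrix (Fin n) (Fin n) ℝ) :=
  {A | IsWeightMatrix G A ∧ StrictlyDiagDominant A}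

/-- The Euclidean norm of the `i`-th row of a matrix. -/
noncomputable def rowNorm {n d : ℕ} (Z : Matrix (Fin n) (Fin d) ℝ) (i : Fin n) : ℝ :=
  ‖WithLp.toLp 2 (Z i)‖

/-- The product of `n` unit spheres of `ℝ^d`: the `n × d` matrices whose rows are unit vectors. -/
def sphereProduct (n d : ℕ) : Set (Matrix (Fin n) (Fin d) ℝ) :=
  {X | ∀ i, rowNorm X i = 1}

/-- The diagonal matrix of inverse row norms. -/
noncomputable def invRowNorms {n d : ℕ} (Z : Matrix (Fin n) (Fin d) ℝ) :
    Matrix (Fin n) (Fin n) ℝ :=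
  Matrix.diagonal fun i => (rowNorm Z i)⁻¹

/-- One step of the consensus algorithm: row `i` of the new state is `∑ j, a i j • x j`,
normalized. -/
noncomputable def step {n : ℕ} (d : ℕ) (A : Matrix (Fin n) (Fin n) ℝ)
    (X : Matrix (Fin n) (Fin d) ℝ) : Matrix (Fin n) (Fin d) ℝ :=
  invRowNorms (A * X) * A * X

/-- The fixed points in the product of spheres of the algorithm with weight matrix `A`. -/
def fixedPts {n : ℕ} (d : ℕ) (A : Matrix (Fin n) (Fin n) ℝ) :
    Set (Matrix (Fin n) (Fin d) ℝ) :=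
  {X | X ∈ sphereProduct n d ∧ step d A X = X}

/-- The points of the product of spheres of rank one, that is the consensus and antipodal
configurations. -/
def rankOneStates (n d : ℕ) : Set (Matrix (Fin n) (Fin d) ℝ) :=
  {X | X ∈ sphereProduct n d ∧ X.rank = 1}

/-- The positions at which a strictly diagonally dominant weight matrix for `G` is non-zero: the
diagonal and the edges of `G`. -/
def Position {n : ℕ} (G : Digraph (Fin n)) : Type :=
  {p : Fin n × Fin n // p.1 = p.2 ∨ G.Adj p.1 p.2}

noncomputable instance {n : ℕ} (G : Digraph (Fin n)) : Fintype (Position G) :=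
  haveI : Finite (Position G) := Subtype.finite
  Fintype.ofFinite _

open Classical in
/-- The matrix with the given entries at the diagonal and edge positions, and zero elsewhere. -/
noncomputable def toMatrix {n : ℕ} (G : Digraph (Fin n)) (a : Position G → ℝ) :
    Matrix (Fin n) (Fin n) ℝ :=
  Matrix.of fun i j => if h : i = j ∨ G.Adj i j then a ⟨(i, j), h⟩ else 0

/-- Measure zero in the set of strictly diagonally dominant weight matrices for `G`. That set is a
relatively open subset of the coordinate subspace of matrices that vanish off the diagonal and the
edges of `G`, and the measure is the Lebesgue measure of this subspace in its coordinates. -/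
def IsNullInWeightMatrices {n : ℕ} (G : Digraph (Fin n))
    (S : Set (Matrix (Fin n) (Fin n) ℝ)) : Prop :=
  S ⊆ weightMatrices G ∧ MeasureTheory.volume (toMatrix G ⁻¹' S) = 0

end SphereConsensus

/-! Strict diagonal dominance makes every rank-one state fixed, so the exceptional matrices are
those with a fixed point of rank r ≥ 2. In orthonormal coordinates of its row space, such a point is
a spanning family of unit vectors Y i in ℝ^r with each ∑ j, A i j • Y j a multiple of Y i.

If Y i and the rows of r - 1 out-neighbours of i form a basis, the i-th equation determines those r
- 1 weights from Y and the other weights (`solvedWeight_eq`). A unit vector has exactly r - 1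
degrees of freedom, so its chart coordinates can be stored in the vacated slots: A becomes the image
of a parameter vector of the same length under a differentiable map. Rotating one row onto the first
basis vector forces one parameter to vanish. The parameters thus lie in a null set, whose
differentiable image is null (`volume_solvable_eq_zero`). There are countably many combinatorial
types of fixed point.

The bases come from the graph hypotheses (`exists_type_of_isComplete`,
`exists_type_of_stronglyConnected`). A node without a suitable basis is sent by ρ to one that has a
basis and an equal or opposite row; it needs no parameters. -/

namespace SphereConsensus

open MeasureTheory

/-! ### An affine chart of the sphere -/

/-- The unit vector proportional to the vector with `k`-th coordinate `1` and remaining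
coordinates `t`. -/
noncomputable def chartPoint {s : ℕ} (k : Fin (s + 1)) (t : Fin s → ℝ) : Fin (s + 1) → ℝ :=
  fun m => (√(∑ q, (k.insertNth (α := fun _ => ℝ) 1 t q) ^ 2))⁻¹ *
    k.insertNth (α := fun _ => ℝ) 1 t m

lemma differentiable_insertNth_apply {E : Type*} [NormedAddCommGroup E] [NormedSpace ℝ E] {s : ℕ}
    (k : Fin (s + 1)) {t : E → Fin s → ℝ} (ht : ∀ l, Differentiable ℝ fun p => t p l)
    (m : Fin (s + 1)) :
    Differentiable ℝ fun p => k.insertNth (α := fun _ => ℝ) 1 (t p) m := by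
  induction m using Fin.succAboveCases k with
  | x => simp
  | p l => simpa using ht l

lemma sum_sq_insertNth_pos {s : ℕ} (k : Fin (s + 1)) (t : Fin s → ℝ) :
    0 < ∑ q, (k.insertNth (α := fun _ => ℝ) 1 t q) ^ 2 := by
  refine Finset.sum_pos' (fun _ _ => sq_nonneg _) ⟨k, Finset.mem_univ _, ?_⟩
  simp

lemma differentiable_chartPoint {E : Type*} [NormedAddCommGroup E] [NormedSpace ℝ E] {s : ℕ}
    (k : Fin (s + 1)) {t : E → Fin s → ℝ} (ht : ∀ l, Differentiable ℝ fun p => t p l)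
    (m : Fin (s + 1)) :
    Differentiable ℝ fun p => chartPoint k (t p) m := by
  have h := differentiable_insertNth_apply k ht
  unfold chartPoint
  refine Differentiable.mul (Differentiable.inv (Differentiable.sqrt ?_ ?_) ?_) (h m)
  · exact Differentiable.fun_sum fun q _ => (h q).pow 2
  · exact fun p => (sum_sq_insertNth_pos k (t p)).ne'
  · exact fun p => (Real.sqrt_pos.2 (sum_sq_insertNth_pos k (t p))).ne'

lemma chartPoint_of_unit {s : ℕ} {k : Fin (s + 1)} {u : Fin (s + 1) → ℝ}
    (hu : ∑ m, u m ^ 2 = 1) (hk : 0 < u k) :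
    chartPoint k (fun l => u (k.succAbove l) / u k) = u := by
  have h : ∀ m, k.insertNth (α := fun _ => ℝ) 1 (fun l => u (k.succAbove l) / u k) m
      = u m / u k := by
    intro m
    induction m using Fin.succAboveCases k with
    | x => simp [hk.ne']
    | p l => simp
  funext m
  simp only [chartPoint, h, div_pow, ← Finset.sum_div, hu]
  rw [one_div, Real.sqrt_inv, Real.sqrt_sq hk.le, inv_inv]
  field_simp

/-! ### Solving the fixed point equations for some of the weights -/

section Solve

variable {n s : ℕ}

/-- The square matrix whose rows are `Y i` and the vectors `Y (J i l)`. -/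
def frame (J : Fin n → Fin s → Fin n) (Y : Fin n → Fin (s + 1) → ℝ) (i : Fin n) :
    Matrix (Fin (s + 1)) (Fin (s + 1)) ℝ :=
  Matrix.of (Fin.cons (Y i) fun l => Y (J i l))

@[simp] lemma frame_zero (J : Fin n → Fin s → Fin n) (Y : Fin n → Fin (s + 1) → ℝ) (i : Fin n) :
    frame J Y i 0 = Y i := rfl

@[simp] lemma frame_succ (J : Fin n → Fin s → Fin n) (Y : Fin n → Fin (s + 1) → ℝ) (i : Fin n)
    (l : Fin s) : frame J Y i l.succ = Y (J i l) := rfl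

lemma injective_of_det_frame_ne_zero {J : Fin n → Fin s → Fin n} {Y : Fin n → Fin (s + 1) → ℝ}
    {i : Fin n} (h : (frame J Y i).det ≠ 0) : Function.Injective (J i) := by
  intro l l' hl
  by_contra hne
  exact h (Matrix.det_zero_of_row_eq (i := l.succ) (j := l'.succ) (by simpa using hne)
    (by simp [hl]))

lemma apply_ne_of_det_frame_ne_zero {J : Fin n → Fin s → Fin n} {Y : Fin n → Fin (s + 1) → ℝ}
    {i : Fin n} (h : (frame J Y i).det ≠ 0) (l : Fin s) : J i l ≠ i := by
  intro hl
  exact h (Matrix.det_zero_of_row_eq (i := l.succ) (j := 0) (Fin.succ_ne_zero l) (by simp [hl]))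

open Classical in
/-- The part of the `i`-th fixed point equation that does not involve `Y i` and the
vectors `Y (J i l)`. -/
noncomputable def remainder (A : Matrix (Fin n) (Fin n) ℝ) (J : Fin n → Fin s → Fin n)
    (Y : Fin n → Fin (s + 1) → ℝ) (i : Fin n) : Fin (s + 1) → ℝ :=
  -∑ j with j ≠ i ∧ ∀ l, J i l ≠ j, A i j • Y j

/-- The value of the weight at `(i, J i l)` determined by the `i`-th fixed point equation, by
Cramer's rule. -/
noncomputable def solvedWeight (A : Matrix (Fin n) (Fin n) ℝ) (J : Fin n → Fin s → Fin n)
    (Y : Fin n → Fin (s + 1) → ℝ) (i : Fin n) (l : Fin s) : ℝ :=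
  (frame J Y i)ᵀ.cramer (remainder A J Y i) l.succ / (frame J Y i).det

/-- The solved values never read the slots they fill, so those slots are free to carry chart
coordinates. -/
lemma solvedWeight_congr {A B : Matrix (Fin n) (Fin n) ℝ} {J : Fin n → Fin s → Fin n}
    {Y : Fin n → Fin (s + 1) → ℝ} {i : Fin n} (h : ∀ j, (∀ l, J i l ≠ j) → A i j = B i j)
    (l : Fin s) : solvedWeight A J Y i l = solvedWeight B J Y i l := by
  have : remainder A J Y i = remainder B J Y i := by
    unfold remainder
    congr 1
    refine Finset.sum_congr rfl fun j hj => ?_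
    rw [h j (Finset.mem_filter.1 hj).2.2]
  rw [solvedWeight, solvedWeight, this]

lemma solvedWeight_eq {A : Matrix (Fin n) (Fin n) ℝ} {J : Fin n → Fin s → Fin n}
    {Y : Fin n → Fin (s + 1) → ℝ} {i : Fin n} (hdet : (frame J Y i).det ≠ 0) {c : ℝ}
    (hc : ∑ j, A i j • Y j = c • Y i) (l : Fin s) :
    solvedWeight A J Y i l = A i (J i l) := by
  classical
  have hinj := injective_of_det_frame_ne_zero hdet
  have hne := apply_ne_of_det_frame_ne_zero hdet
  -- The fixed point equation expands the remainder in the basis given by the frame; Cramer's rule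
  -- then reads off the coefficients.
  have hrem : remainder A J Y i =
      ∑ m, (Fin.cons (A i i - c) (fun l => A i (J i l)) : Fin (s + 1) → ℝ) m • frame J Y i m := by
    rw [Fin.sum_univ_succ]
    simp only [Fin.cons_zero, Fin.cons_succ, frame_zero, frame_succ, remainder]
    have h1 : ∑ l, A i (J i l) • Y (J i l) = ∑ j with j ≠ i ∧ ∃ l, J i l = j, A i j • Y j := by
      rw [← Finset.sum_image (f := fun j => A i j • Y j) (g := J i) (s := Finset.univ)
        hinj.injOn]
      refine Finset.sum_congr ?_ fun _ _ => rfl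
      ext j
      simp only [Finset.mem_image, Finset.mem_univ, true_and, Finset.mem_filter]
      exact ⟨fun ⟨l, hl⟩ => ⟨hl ▸ hne l, l, hl⟩, fun h => h.2⟩
    have h2 : ∑ j, A i j • Y j = A i i • Y i + (∑ j with j ≠ i ∧ ∃ l, J i l = j, A i j • Y j +
        ∑ j with j ≠ i ∧ ∀ l, J i l ≠ j, A i j • Y j) := by
      rw [← Finset.add_sum_erase _ _ (Finset.mem_univ i),
        ← Finset.sum_filter_add_sum_filter_not (Finset.univ.erase i) fun j => ∃ l, J i l = j]
      congr 2 <;> refine Finset.sum_congr ?_ fun _ _ => rfl <;> ext j <;> simp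
    rw [h2, ← h1] at hc
    rw [sub_smul, ← hc]
    abel
  rw [solvedWeight, hrem, map_sum, div_eq_iff hdet, Finset.sum_apply]
  simp only [map_smul, Matrix.cramer_transpose_row_self, Pi.smul_apply, smul_eq_mul]
  rw [Finset.sum_eq_single l.succ]
  · simp
  · intro b _ hb
    simp [hb.symm]
  · simp

end Solve

/-! ### Differentiability of the solved weights -/

section Differentiability

variable {E : Type*} [NormedAddCommGroup E] [NormedSpace ℝ E]

lemma differentiable_det {m : ℕ} {M : E → Matrix (Fin m) (Fin m) ℝ}
    (hM : ∀ i j, Differentiable ℝ fun p => M p i j) : Differentiable ℝ fun p => (M p).det := by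
  simp only [Matrix.det_apply]
  refine Differentiable.fun_sum fun σ _ => Differentiable.const_smul ?_ _
  fun_prop

lemma differentiable_det_frame {n s : ℕ} {J : Fin n → Fin s → Fin n}
    {Y : E → Fin n → Fin (s + 1) → ℝ} (hY : ∀ j m, Differentiable ℝ fun p => Y p j m) (i : Fin n) :
    Differentiable ℝ fun p => (frame J (Y p) i).det := by
  refine differentiable_det fun a b => ?_
  induction a using Fin.cases with
  | zero => simpa using hY i b
  | succ l => simpa using hY (J i l) b

lemma differentiableAt_solvedWeight {n s : ℕ} {J : Fin n → Fin s → Fin n}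
    {A : E → Matrix (Fin n) (Fin n) ℝ} {Y : E → Fin n → Fin (s + 1) → ℝ}
    (hA : ∀ i j, Differentiable ℝ fun p => A p i j)
    (hY : ∀ j m, Differentiable ℝ fun p => Y p j m) {i : Fin n} {p : E}
    (hdet : (frame J (Y p) i).det ≠ 0) (l : Fin s) :
    DifferentiableAt ℝ (fun p => solvedWeight (A p) J (Y p) i l) p := by
  unfold solvedWeight
  simp only [div_eq_mul_inv]
  refine DifferentiableAt.mul ?_ (DifferentiableAt.inv (differentiable_det_frame hY i p) hdet)
  simp only [Matrix.cramer_transpose_apply]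
  refine (differentiable_det fun a b => ?_) p
  by_cases h : a = l.succ
  · subst h
    simp only [Matrix.updateRow_self, remainder, Pi.neg_apply, Finset.sum_apply, Pi.smul_apply,
      smul_eq_mul]
    exact (Differentiable.fun_sum fun j _ => (hA i j).mul (hY j b)).neg
  · simp only [Matrix.updateRow_ne h]
    induction a using Fin.cases with
    | zero => simpa using hY i b
    | succ l => simpa using hY (J i l) b

end Differentiability

/-! ### The null set of weights admitting a fixed point of a given combinatorial type -/

section Core

variable {n s : ℕ} {G : Digraph (Fin n)}

lemma toMatrix_apply {a : Position G → ℝ} (q : Position G) :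
    toMatrix G a q.1.1 q.1.2 = a q := by
  have h := q.2
  simp only [toMatrix, Matrix.of_apply, dif_pos h]
  rfl

lemma differentiable_toMatrix (i j : Fin n) :
    Differentiable ℝ fun a : Position G → ℝ => toMatrix G a i j := by
  by_cases h : i = j ∨ G.Adj i j
  · simp only [toMatrix, Matrix.of_apply, dif_pos h]
    fun_prop
  · simp only [toMatrix, Matrix.of_apply, dif_neg h]
    fun_prop

/-- The configuration whose row `j` is `ε j` times the unit vector with chart `k (ρ j)` and
chart coordinates the entries of `a` at the positions `(ρ j, J (ρ j) l)`. -/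
noncomputable def chartState (ρ : Fin n → Fin n) (ε : Fin n → ℤˣ) (k : Fin n → Fin (s + 1))
    (J : Fin n → Fin s → Fin n) (a : Position G → ℝ) (j : Fin n) : Fin (s + 1) → ℝ :=
  ((ε j : ℤ) : ℝ) • chartPoint (k (ρ j)) fun l => toMatrix G a (ρ j) (J (ρ j) l)

lemma differentiable_chartState (ρ : Fin n → Fin n) (ε : Fin n → ℤˣ) (k : Fin n → Fin (s + 1))
    (J : Fin n → Fin s → Fin n) (j : Fin n) (m : Fin (s + 1)) :
    Differentiable ℝ fun a : Position G → ℝ => chartState ρ ε k J a j m := by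
  simp only [chartState, Pi.smul_apply, smul_eq_mul]
  exact (differentiable_chartPoint _ (fun l => differentiable_toMatrix _ _) m).const_mul _

open Classical in
/-- The weights whose entries at the positions `(i, J i l)` with `ρ i = i` are obtained by solving
the fixed point equations of the configuration that these entries of `a` parametrize. -/
noncomputable def solvedWeights (ρ : Fin n → Fin n) (ε : Fin n → ℤˣ) (k : Fin n → Fin (s + 1))
    (J : Fin n → Fin s → Fin n) (a : Position G → ℝ) : Position G → ℝ := fun q =>
  if h : ρ q.1.1 = q.1.1 ∧ ∃ l, J q.1.1 l = q.1.2 then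
    solvedWeight (toMatrix G a) J (chartState ρ ε k J a) q.1.1 h.2.choose
  else a q

lemma differentiableAt_solvedWeights {ρ : Fin n → Fin n} {ε : Fin n → ℤˣ}
    {k : Fin n → Fin (s + 1)} {J : Fin n → Fin s → Fin n} {a : Position G → ℝ}
    (h : ∀ i, ρ i = i → (frame J (chartState ρ ε k J a) i).det ≠ 0) :
    DifferentiableAt ℝ (solvedWeights ρ ε k J) a := by
  rw [differentiableAt_pi]
  intro q
  unfold solvedWeights
  split_ifs with hq
  · exact differentiableAt_solvedWeight differentiable_toMatrix
      (differentiable_chartState ρ ε k J) (h _ hq.1) _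
  · fun_prop

theorem volume_solvable_eq_zero (ρ : Fin n → Fin n) (ε : Fin n → ℤˣ)
    (k : Fin n → Fin (s + 2)) (J : Fin n → Fin (s + 1) → Fin n)
    (hρ : ∀ i, ρ (ρ i) = ρ i) (hJ : ∀ i, ρ i = i → ∀ l, G.Adj i (J i l))
    (i₀ : Fin n) (hi₀ : ρ i₀ = i₀) (hk : k i₀ = 0) :
    volume {a : Position G → ℝ | ∃ Y u : Fin n → Fin (s + 2) → ℝ,
      (∀ i, Y i = ((ε i : ℤ) : ℝ) • u (ρ i)) ∧ (∀ i, ∑ m, u i m ^ 2 = 1) ∧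
      (∀ i, ρ i = i → 0 < u i (k i)) ∧ u i₀ = Pi.single 0 1 ∧
      (∀ i, ρ i = i → (frame J Y i).det ≠ 0) ∧
      ∀ i, ∃ c : ℝ, ∑ j, toMatrix G a i j • Y j = c • Y i} = 0 := by
  classical
  -- In chart 0 the first basis vector has zero chart coordinates, which puts the parameters in a
  -- hyperplane; the determinant condition gives differentiability.
  set D : Set (Position G → ℝ) := {p | toMatrix G p i₀ (J i₀ 0) = 0 ∧
    ∀ i, ρ i = i → (frame J (chartState ρ ε k J p) i).det ≠ 0} with hD
  have hDnull : volume D = 0 := by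
    let q₀ : Position G := ⟨(i₀, J i₀ 0), Or.inr (hJ i₀ hi₀ 0)⟩
    refine measure_mono_null (t := {p | p q₀ = 0}) ?_
      (Measure.pi_hyperplane (fun _ : Position G => (volume : Measure ℝ)) q₀ 0)
    rintro p ⟨hp, -⟩
    exact (toMatrix_apply q₀).symm.trans hp
  have hdiff : DifferentiableOn ℝ (solvedWeights (G := G) ρ ε k J) D := fun p hp =>
    (differentiableAt_solvedWeights hp.2).differentiableWithinAt
  refine measure_mono_null ?_
    (addHaar_image_eq_zero_of_differentiableOn_of_addHaar_eq_zero volume hdiff hDnull)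
  rintro a ⟨Y, u, hY, hu, hpos, hu₀, hdet, hc⟩
  -- The preimage of `a`: the solved slots are overwritten by the chart coordinates of `u`.
  let p : Position G → ℝ := fun q =>
    if h : ρ q.1.1 = q.1.1 ∧ ∃ l, J q.1.1 l = q.1.2 then
      u q.1.1 ((k q.1.1).succAbove h.2.choose) / u q.1.1 (k q.1.1)
    else a q
  have hp1 : ∀ i, ρ i = i → ∀ l,
      toMatrix G p i (J i l) = u i ((k i).succAbove l) / u i (k i) := by
    intro i hi l
    have hex : ρ i = i ∧ ∃ l', J i l' = J i l := ⟨hi, l, rfl⟩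
    have h := toMatrix_apply (a := p) ⟨(i, J i l), Or.inr (hJ i hi l)⟩
    refine h.trans ?_
    simp only [p]
    rw [dif_pos hex, injective_of_det_frame_ne_zero (hdet i hi) hex.2.choose_spec]
  have hchart : ∀ i, ρ i = i →
      chartPoint (k i) (fun l => toMatrix G p i (J i l)) = u i := by
    intro i hi
    simp only [hp1 i hi]
    exact chartPoint_of_unit (hu i) (hpos i hi)
  have hstate : chartState ρ ε k J p = Y := by
    funext i
    rw [chartState, hchart _ (hρ i), hY]
  refine ⟨p, ⟨?_, ?_⟩, ?_⟩
  · rw [hp1 i₀ hi₀, hu₀, hk]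
    simp
  · simpa only [hstate] using hdet
  · funext q
    obtain ⟨⟨i, j⟩, hq⟩ := q
    unfold solvedWeights
    split_ifs with h
    · rw [hstate]
      simp only at h ⊢
      have key : ∀ l, solvedWeight (toMatrix G p) J Y i l = toMatrix G a i (J i l) := by
        intro l
        obtain ⟨c, hc⟩ := hc i
        rw [← solvedWeight_eq (hdet i h.1) hc l]
        refine solvedWeight_congr (fun j hj => ?_) l
        by_cases hadj : i = j ∨ G.Adj i j
        · have h1 := toMatrix_apply (a := p) ⟨(i, j), hadj⟩
          have h2 := toMatrix_apply (a := a) ⟨(i, j), hadj⟩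
          refine h1.trans (Eq.trans ?_ h2.symm)
          simp only [p]
          rw [dif_neg]
          rintro ⟨-, l, hl⟩
          exact hj l hl
        · simp [toMatrix, hadj]
      rw [key, h.2.choose_spec]
      exact toMatrix_apply (a := a) ⟨(i, j), hq⟩
    · simp only [p]
      rw [dif_neg h]

end Core

/-! ### Fixed points -/

section FixedPoints

variable {n d : ℕ}

lemma toLp_mul_row (A : Matrix (Fin n) (Fin n) ℝ) (X : Matrix (Fin n) (Fin d) ℝ) (i : Fin n) :
    WithLp.toLp 2 ((A * X) i) = ∑ j, A i j • WithLp.toLp 2 (X j) := by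
  ext m
  simp [Matrix.mul_apply]

lemma step_apply (A : Matrix (Fin n) (Fin n) ℝ) (X : Matrix (Fin n) (Fin d) ℝ) (i : Fin n)
    (m : Fin d) : step d A X i m = (rowNorm (A * X) i)⁻¹ * (A * X) i m := by
  rw [step, invRowNorms, Matrix.mul_assoc, Matrix.diagonal_mul]

lemma finrank_span_rows (X : Matrix (Fin n) (Fin d) ℝ) :
    Module.finrank ℝ (Submodule.span ℝ (Set.range fun i => WithLp.toLp 2 (X i))) = X.rank := by
  rw [Matrix.rank_eq_finrank_span_row,
    ← LinearEquiv.finrank_map_eq (WithLp.linearEquiv 2 ℝ (Fin d → ℝ)).symm, Submodule.map_span,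
    ← Set.range_comp]
  rfl

lemma exists_smul_of_rank_eq_one {X : Matrix (Fin n) (Fin d) ℝ} (hX : X ∈ sphereProduct n d)
    (hr : X.rank = 1) (i₀ i : Fin n) :
    ∃ c : ℝ, c * c = 1 ∧ X i = c • X i₀ := by
  rw [← finrank_span_rows] at hr
  have hmem : ∀ j, WithLp.toLp 2 (X j) ∈
      Submodule.span ℝ (Set.range fun i => WithLp.toLp 2 (X i)) :=
    fun j => Submodule.subset_span ⟨j, rfl⟩
  have h0 : (⟨_, hmem i₀⟩ : Submodule.span ℝ (Set.range fun i => WithLp.toLp 2 (X i))) ≠ 0 := by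
    intro h
    have h1 : WithLp.toLp 2 (X i₀) = 0 := congrArg Subtype.val h
    have h2 : ‖WithLp.toLp 2 (X i₀)‖ = 1 := hX i₀
    simp [h1] at h2
  obtain ⟨c, hc⟩ := (finrank_eq_one_iff_of_nonzero' _ h0).1 hr ⟨_, hmem i⟩
  have hc' : c • WithLp.toLp 2 (X i₀) = WithLp.toLp 2 (X i) := congrArg Subtype.val hc
  refine ⟨c, ?_, ?_⟩
  · have h1 : ‖WithLp.toLp 2 (X i)‖ = 1 := hX i
    have h2 : ‖WithLp.toLp 2 (X i₀)‖ = 1 := hX i₀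
    rw [← hc', norm_smul, h2, mul_one, Real.norm_eq_abs] at h1
    rw [← abs_mul_abs_self, h1, one_mul]
  · exact (congrArg WithLp.ofLp hc').symm

theorem rankOneStates_subset_fixedPts {G : Digraph (Fin n)} {A : Matrix (Fin n) (Fin n) ℝ}
    (hA : A ∈ weightMatrices G) : rankOneStates n d ⊆ fixedPts d A := by
  rintro X ⟨hX, hr⟩
  refine ⟨hX, ?_⟩
  ext i m
  choose c hc hXc using exists_smul_of_rank_eq_one hX hr i
  have hrow : (A * X) i = (∑ j, A i j * c j) • X i := by
    ext m
    simp only [Matrix.mul_apply, Pi.smul_apply, smul_eq_mul, Finset.sum_mul]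
    refine Finset.sum_congr rfl fun j _ => ?_
    rw [hXc j, Pi.smul_apply, smul_eq_mul, mul_assoc]
  -- The signs are taken relative to row `i` itself, so the dominant diagonal term enters with a
  -- plus sign.
  have hci : c i = 1 := by
    have h1 : ‖WithLp.toLp 2 (X i)‖ = 1 := hX i
    have h2 : X i ≠ 0 := by
      intro h
      simp [h] at h1
    have h3 := hXc i
    by_contra hne
    exact h2 ((smul_eq_zero.1 (by rw [sub_smul, one_smul, ← h3, sub_self] :
      (c i - 1) • X i = 0)).resolve_left (sub_ne_zero.2 hne))
  have hpos : 0 < ∑ j, A i j * c j := by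
    rw [← Finset.add_sum_erase _ _ (Finset.mem_univ i), hci, mul_one]
    have h1 : -∑ j ∈ Finset.univ.erase i, A i j ≤ ∑ j ∈ Finset.univ.erase i, A i j * c j := by
      rw [← Finset.sum_neg_distrib]
      refine Finset.sum_le_sum fun j _ => ?_
      have := hA.1.1 i j
      rcases mul_self_eq_one_iff.1 (hc j) with h | h <;> rw [h] <;> linarith
    have h2 := hA.2 i
    linarith
  have hnorm : rowNorm (A * X) i = ∑ j, A i j * c j := by
    have h1 : ‖WithLp.toLp 2 (X i)‖ = 1 := hX i
    rw [rowNorm, hrow, WithLp.toLp_smul, norm_smul, h1, mul_one, Real.norm_of_nonneg hpos.le]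
  rw [step_apply, hnorm, hrow, Pi.smul_apply, smul_eq_mul, inv_mul_cancel_left₀ hpos.ne']

/-- A fixed point that is not of rank one, in orthonormal coordinates of its row space. -/
theorem exists_coordinates {A : Matrix (Fin n) (Fin n) ℝ} {X : Matrix (Fin n) (Fin d) ℝ}
    (hX : X ∈ fixedPts d A) (hr : X.rank ≠ 1) (i₁ : Fin n) :
    ∃ s, s + 2 ≤ d ∧ ∃ Y : Fin n → Fin (s + 2) → ℝ, (∀ i, ∑ m, Y i m ^ 2 = 1) ∧
      Submodule.span ℝ (Set.range Y) = ⊤ ∧ Y i₁ = Pi.single 0 1 ∧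
      ∀ i, ∃ c : ℝ, ∑ j, A i j • Y j = c • Y i := by
  obtain ⟨hX, hfix⟩ := hX
  have hx1 : ∀ i, ‖WithLp.toLp 2 (X i)‖ = 1 := hX
  set V := Submodule.span ℝ (Set.range fun i => WithLp.toLp 2 (X i)) with hV
  have hmem : ∀ j, WithLp.toLp 2 (X j) ∈ V := fun j => Submodule.subset_span ⟨j, rfl⟩
  let x : Fin n → V := fun j => ⟨_, hmem j⟩
  have hnx : ∀ i, ‖x i‖ = 1 := hx1
  have hrank : Module.finrank ℝ V = X.rank := finrank_span_rows X
  have hpos : 0 < Module.finrank ℝ V := by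
    have : Nontrivial V := ⟨x i₁, 0, fun h => by simpa [h] using hnx i₁⟩
    exact Module.finrank_pos
  obtain ⟨s, hs⟩ : ∃ s, Module.finrank ℝ V = s + 2 := ⟨Module.finrank ℝ V - 2, by omega⟩
  obtain ⟨b, hb⟩ := Orthonormal.exists_orthonormalBasis_extension_of_card_eq (𝕜 := ℝ) (E := V)
    (ι := Fin (s + 2)) (by simpa using hs) (v := fun _ => x i₁) (s := {0})
    ⟨fun _ => hnx i₁, fun i j hij => (hij (Subsingleton.elim i j)).elim⟩
  let φ : V ≃ₗ[ℝ] (Fin (s + 2) → ℝ) :=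
    b.repr.toLinearEquiv.trans (WithLp.linearEquiv 2 ℝ (Fin (s + 2) → ℝ))
  refine ⟨s, ?_, fun i => φ (x i), ?_, ?_, ?_, ?_⟩
  · rw [← hs]
    simpa using Submodule.finrank_le V
  · intro i
    have := EuclideanSpace.real_norm_sq_eq (b.repr (x i))
    rw [LinearIsometryEquiv.norm_map, hnx i, one_pow] at this
    exact this.symm
  · have htop : Submodule.span ℝ (Set.range x) = ⊤ := by
      apply Submodule.map_injective_of_injective V.subtype_injective
      rw [Submodule.map_span, ← Set.range_comp, Submodule.map_top, Submodule.range_subtype]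
      rfl
    have := congrArg (Submodule.map (φ : V →ₗ[ℝ] (Fin (s + 2) → ℝ))) htop
    rw [Submodule.map_span, ← Set.range_comp, Submodule.map_top, LinearEquiv.range] at this
    exact this
  · have h := hb 0 rfl
    funext m
    have := congrArg (fun v => v m) (b.repr_self 0)
    rw [h] at this
    exact this.trans (by simp [Pi.single_apply])
  · intro i
    refine ⟨rowNorm (A * X) i, ?_⟩
    have h : ∑ j, A i j • x j = rowNorm (A * X) i • x i := by
      apply Subtype.ext
      simp only [AddSubmonoidClass.coe_finsetSum, SetLike.val_smul, x]
      rw [← toLp_mul_row]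
      ext m
      have h1 : X i m = (rowNorm (A * X) i)⁻¹ * (A * X) i m := by
        rw [← step_apply, hfix]
      -- Since `0⁻¹ = 0`, a vanishing norm would make row `i` of the fixed point zero.
      have h2 : rowNorm (A * X) i ≠ 0 := by
        intro h0
        have h3 : X i = 0 := by
          funext m
          rw [← hfix, step_apply, h0]
          simp
        have h4 := hx1 i
        simp [h3] at h4
      simp only [PiLp.smul_apply, smul_eq_mul]
      rw [h1, mul_inv_cancel_left₀ h2]
    have := congrArg φ h
    simpa only [map_sum, map_smul] using this

end FixedPoints

/-! ### Combinatorial types -/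

section Types

variable {n : ℕ} {G : Digraph (Fin n)}

lemma exists_frame {s : ℕ} {Y : Fin n → Fin (s + 1) → ℝ}
    (hY : Submodule.span ℝ (Set.range Y) = ⊤) {i : Fin n} (hi : Y i ≠ 0) :
    ∃ j : Fin s → Fin n,
      (Matrix.of (Fin.cons (Y i) fun l => Y (j l)) : Matrix _ _ ℝ).det ≠ 0 := by
  classical
  obtain ⟨b, -, hib, hspan, hli⟩ := exists_linearIndepOn_extension (K := ℝ) (v := Y)
    (LinearIndepOn.singleton hi) (Set.subset_univ {i})
  have hspan' : ⊤ ≤ Submodule.span ℝ (Set.range fun j : b => Y j) := by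
    rw [← hY, Submodule.span_le]
    rw [Set.image_univ, Set.image_eq_range] at hspan
    exact hspan
  let B : Module.Basis b ℝ (Fin (s + 1) → ℝ) := Module.Basis.mk hli hspan'
  have hcard : Fintype.card b = s + 1 := by
    rw [← Module.finrank_eq_card_basis B]
    simp
  let e₀ : Fin (s + 1) ≃ b := (Fintype.equivFinOfCardEq hcard).symm
  let i' : b := ⟨i, hib rfl⟩
  -- The swap puts `i` at index 0, as the frame requires.
  let e : Fin (s + 1) ≃ b := (Equiv.swap 0 (e₀.symm i')).trans e₀
  have he : e 0 = i' := by simp [e]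
  refine ⟨fun l => e l.succ, ?_⟩
  have hM : (Matrix.of (Fin.cons (Y i) fun l => Y (e l.succ)) : Matrix _ _ ℝ) =
      Matrix.of fun m => Y (e m) := by
    congr 1
    funext m
    induction m using Fin.cases with
    | zero => simp [he, i']
    | succ l => simp
  rw [hM, ← isUnit_iff_ne_zero, ← Matrix.isUnit_iff_isUnit_det,
    ← Matrix.linearIndependent_rows_iff_isUnit]
  exact LinearIndependent.comp (v := fun j : b => Y j) hli e e.injective

/-- Any nonzero row extends to a basis by other rows, and completeness makes all of them
out-neighbours; hence ρ is the identity. -/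
theorem exists_type_of_isComplete (hG : IsComplete G) {s : ℕ} {Y : Fin n → Fin (s + 2) → ℝ}
    (hunit : ∀ i, ∑ m, Y i m ^ 2 = 1) (hY : Submodule.span ℝ (Set.range Y) = ⊤) :
    ∃ (ρ : Fin n → Fin n) (J : Fin n → Fin (s + 1) → Fin n), (∀ i, ρ (ρ i) = ρ i) ∧
      (∀ i, Y i = Y (ρ i) ∨ Y i = -Y (ρ i)) ∧
      (∀ i, ρ i = i → ∀ l, G.Adj i (J i l)) ∧ ∀ i, ρ i = i → (frame J Y i).det ≠ 0 := by
  have hne : ∀ i, Y i ≠ 0 := by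
    intro i h
    simpa [h] using hunit i
  choose J hJ using fun i => exists_frame hY (hne i)
  exact ⟨id, J, fun _ => rfl, fun _ => Or.inl rfl,
    fun i _ l => hG _ _ (apply_ne_of_det_frame_ne_zero (hJ i) l).symm, fun i _ => hJ i⟩

/-- A vanishing cross product gives u = ⟨u, v⟩ v, and Lagrange's identity gives ⟨u, v⟩² = 1. -/
lemma eq_or_eq_neg_of_cross_eq_zero {u v : Fin 2 → ℝ} (hu : ∑ m, u m ^ 2 = 1)
    (hv : ∑ m, v m ^ 2 = 1) (h : u 0 * v 1 - u 1 * v 0 = 0) : u = v ∨ u = -v := by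
  rw [Fin.sum_univ_two] at hu hv
  have h0 : u 0 = (u 0 * v 0 + u 1 * v 1) * v 0 := by linear_combination v 1 * h - u 0 * hv
  have h1 : u 1 = (u 0 * v 0 + u 1 * v 1) * v 1 := by linear_combination -v 0 * h - u 1 * hv
  have hc : (u 0 * v 0 + u 1 * v 1) * (u 0 * v 0 + u 1 * v 1) = 1 := by
    linear_combination hu * (v 0 ^ 2 + v 1 ^ 2) + hv - (u 0 * v 1 - u 1 * v 0) * h
  rcases mul_self_eq_one_iff.1 hc with hc | hc <;> rw [hc] at h0 h1
  · left
    funext m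
    fin_cases m
    · simpa using h0
    · simpa using h1
  · right
    funext m
    fin_cases m
    · simpa using h0
    · simpa using h1

/-- The rows span the plane, so no class of equal or opposite rows is everything. A path leaving the
class of `i` has an edge by which it first exits; the tail of that edge represents `i`, and in the
plane its row and that of the head form a basis. -/
theorem exists_type_of_stronglyConnected (hG : StronglyConnected G) {Y : Fin n → Fin 2 → ℝ}
    (hunit : ∀ i, ∑ m, Y i m ^ 2 = 1) (hY : Submodule.span ℝ (Set.range Y) = ⊤) :
    ∃ (ρ : Fin n → Fin n) (J : Fin n → Fin 1 → Fin n), (∀ i, ρ (ρ i) = ρ i) ∧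
      (∀ i, Y i = Y (ρ i) ∨ Y i = -Y (ρ i)) ∧
      (∀ i, ρ i = i → ∀ l, G.Adj i (J i l)) ∧ ∀ i, ρ i = i → (frame J Y i).det ≠ 0 := by
  classical
  let R : Fin n → Fin n → Prop := fun i j => Y i = Y j ∨ Y i = -Y j
  have hsymm : ∀ {i j}, R i j → R j i := by
    rintro i j (h | h)
    · exact Or.inl h.symm
    · exact Or.inr (by rw [h, neg_neg])
  have htrans : ∀ {i j l}, R i j → R j l → R i l := by
    rintro i j l (h | h) (h' | h')
    · exact Or.inl (h.trans h')
    · exact Or.inr (h.trans h')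
    · exact Or.inr (by rw [h, h'])
    · exact Or.inl (by rw [h, h', neg_neg])
  let T : Fin n → Prop := fun t => ∃ j, G.Adj t j ∧ ¬R t j
  have key : ∀ i j, Relation.ReflTransGen G.Adj i j → (∃ t, T t ∧ R i t) ∨ R i j := by
    intro i j hij
    induction hij using Relation.ReflTransGen.head_induction_on with
    | refl => exact Or.inr (Or.inl rfl)
    | head hac _ ih =>
      rename_i a c _
      by_cases ha : R a c
      · rcases ih with ⟨t, ht, hct⟩ | h
        · exact Or.inl ⟨t, ht, htrans ha hct⟩
        · exact Or.inr (htrans ha h)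
      · exact Or.inl ⟨a, ⟨c, hac, ha⟩, Or.inl rfl⟩
  have hex : ∀ i, ∃ t, T t ∧ R i t := by
    intro i
    by_contra hno
    have hall : ∀ j, R i j := fun j => (key i j (hG i j)).resolve_left hno
    have hle : (⊤ : Submodule ℝ (Fin 2 → ℝ)) ≤ Submodule.span ℝ {Y i} := by
      rw [← hY, Submodule.span_le]
      rintro _ ⟨j, rfl⟩
      rcases hsymm (hall j) with h | h <;> rw [h]
      · exact Submodule.mem_span_singleton_self _
      · exact Submodule.neg_mem _ (Submodule.mem_span_singleton_self _)
    have h1 := Submodule.finrank_mono hle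
    have h2 := finrank_span_le_card (R := ℝ) {Y i}
    simp at h1 h2
    omega
  choose τ hτ hRτ using hex
  let ρ : Fin n → Fin n := fun i => if T i then i else τ i
  have hρT : ∀ i, T (ρ i) := by
    intro i
    by_cases h : T i
    · simp [ρ, h]
    · simpa [ρ, h] using hτ i
  have hρ : ∀ i, T i → ρ i = i := fun i h => if_pos h
  have hRρ : ∀ i, R i (ρ i) := by
    intro i
    by_cases h : T i
    · exact Or.inl (by rw [hρ i h])
    · simpa only [ρ, if_neg h] using hRτ i
  have hJ : ∀ i, ∃ j, T i → G.Adj i j ∧ ¬R i j := by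
    intro i
    by_cases h : T i
    · exact ⟨h.choose, fun _ => h.choose_spec⟩
    · exact ⟨i, fun h' => (h h').elim⟩
  choose J hJ using hJ
  refine ⟨ρ, fun i _ => J i, fun i => hρ _ (hρT i), hRρ,
    fun i hi _ => (hJ i (hi ▸ hρT i)).1, fun i hi hdet => (hJ i (hi ▸ hρT i)).2 ?_⟩
  refine eq_or_eq_neg_of_cross_eq_zero (hunit _) (hunit _) ?_
  rw [Matrix.det_fin_two] at hdet
  exact hdet

end Types

/-! ### Sign and chart choices, and the union over combinatorial types -/

section Union

variable {n : ℕ} {G : Digraph (Fin n)}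

lemma exists_unit_int_mul_pos {x : ℝ} (hx : x ≠ 0) : ∃ δ : ℤˣ, 0 < ((δ : ℤ) : ℝ) * x := by
  rcases lt_or_gt_of_ne hx with h | h
  · exact ⟨-1, by simpa using h⟩
  · exact ⟨1, by simpa using h⟩

lemma unit_int_mul_self (δ : ℤˣ) : ((δ : ℤ) : ℝ) * ((δ : ℤ) : ℝ) = 1 := by
  rcases Int.units_eq_one_or δ with h | h <;> simp [h]

/-- The weights for which there is a fixed point configuration of unit vectors that depends, up
to signs, only on its rows `Y i` with `ρ i = i`, each of which forms with the rows
`Y (J i l)` a basis. -/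
theorem volume_fixedPt_type_eq_zero {s : ℕ} (ρ : Fin n → Fin n)
    (J : Fin n → Fin (s + 1) → Fin n) (hρ : ∀ i, ρ (ρ i) = ρ i)
    (hJ : ∀ i, ρ i = i → ∀ l, G.Adj i (J i l)) (i₁ : Fin n) :
    volume {a : Position G → ℝ | ∃ Y : Fin n → Fin (s + 2) → ℝ,
      (∀ i, ∑ m, Y i m ^ 2 = 1) ∧ Y i₁ = Pi.single 0 1 ∧
      (∀ i, Y i = Y (ρ i) ∨ Y i = -Y (ρ i)) ∧ (∀ i, ρ i = i → (frame J Y i).det ≠ 0) ∧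
      ∀ i, ∃ c : ℝ, ∑ j, toMatrix G a i j • Y j = c • Y i} = 0 := by
  refine measure_mono_null ?_ (measure_iUnion_null fun ε : Fin n → ℤˣ =>
    measure_iUnion_null fun k : Fin n → Fin (s + 2) =>
    measure_iUnion_null fun hk : k (ρ i₁) = 0 =>
    volume_solvable_eq_zero ρ ε k J hρ hJ (ρ i₁) (hρ i₁) hk)
  rintro a ⟨Y, hunit, hY₁, hYρ, hdet, hc⟩
  have hne : ∀ i, ∃ m, Y i m ≠ 0 := by
    intro i
    by_contra! h
    simpa [h] using hunit i
  choose k hk using hne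
  choose δ hδ using fun i => exists_unit_int_mul_pos (hk i)
  have hσ : ∀ i, ∃ σ : ℤˣ, Y i = ((σ : ℤ) : ℝ) • Y (ρ i) := by
    intro i
    rcases hYρ i with h | h
    · exact ⟨1, by simpa using h⟩
    · exact ⟨-1, by simpa using h⟩
  choose σ hσ using hσ
  have hYi₀ : ∀ m, Y (ρ i₁) m = ((σ i₁ : ℤ) : ℝ) * (Pi.single 0 1 : Fin (s + 2) → ℝ) m := by
    intro m
    rw [← hY₁, hσ i₁, Pi.smul_apply, smul_eq_mul, ← mul_assoc, unit_int_mul_self, one_mul]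
  have hk₀ : k (ρ i₁) = 0 := by
    by_contra h
    exact hk (ρ i₁) (by rw [hYi₀, Pi.single_eq_of_ne h, mul_zero])
  simp only [Set.mem_iUnion]
  -- `δ` flips each row into the half-sphere covered by its chart; the signs `ε` undo this flip and
  -- record the sign relative to the representative.
  refine ⟨fun i => σ i * δ (ρ i), k, hk₀, Y, fun i => ((δ i : ℤ) : ℝ) • Y i, ?_, ?_, ?_, ?_,
    hdet, hc⟩
  · intro i
    rw [smul_smul, Units.val_mul, Int.cast_mul, mul_assoc, unit_int_mul_self, mul_one]
    exact hσ i
  · intro i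
    simp only [Pi.smul_apply, smul_eq_mul, mul_pow, ← Finset.mul_sum, hunit]
    rw [sq, unit_int_mul_self, one_mul]
  · intro i _
    exact hδ i
  · have h := hδ (ρ i₁)
    rw [hk₀, hYi₀, Pi.single_eq_same, mul_one] at h
    have h1 : ((δ (ρ i₁) : ℤ) : ℝ) * ((σ i₁ : ℤ) : ℝ) = 1 := by
      refine (mul_self_eq_one_iff.1 ?_).resolve_right fun h' => by linarith
      rw [mul_mul_mul_comm, unit_int_mul_self, unit_int_mul_self, one_mul]
    funext m
    simp only [Pi.smul_apply, smul_eq_mul]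
    rw [hYi₀, ← mul_assoc, h1, one_mul]

theorem toMatrix_preimage_subset {d : ℕ} (i₁ : Fin n)
    (h : (d = 2 ∧ StronglyConnected G) ∨ (2 ≤ d ∧ IsComplete G)) :
    toMatrix G ⁻¹' {A | A ∈ weightMatrices G ∧ fixedPts d A ≠ rankOneStates n d} ⊆
      ⋃ (s : ℕ) (ρ : Fin n → Fin n) (J : Fin n → Fin (s + 1) → Fin n)
        (_ : ∀ i, ρ (ρ i) = ρ i) (_ : ∀ i, ρ i = i → ∀ l, G.Adj i (J i l)),
      {a : Position G → ℝ | ∃ Y : Fin n → Fin (s + 2) → ℝ,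
        (∀ i, ∑ m, Y i m ^ 2 = 1) ∧ Y i₁ = Pi.single 0 1 ∧
        (∀ i, Y i = Y (ρ i) ∨ Y i = -Y (ρ i)) ∧ (∀ i, ρ i = i → (frame J Y i).det ≠ 0) ∧
        ∀ i, ∃ c : ℝ, ∑ j, toMatrix G a i j • Y j = c • Y i} := by
  rintro a ⟨hA, hne⟩
  obtain ⟨X, hX, hr⟩ : ∃ X ∈ fixedPts d (toMatrix G a), X.rank ≠ 1 := by
    by_contra! hall
    exact hne (Set.Subset.antisymm (fun X hX => ⟨hX.1, hall X hX⟩)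
      (rankOneStates_subset_fixedPts hA))
  obtain ⟨s, hs, Y, hunit, hspan, hY₁, hc⟩ := exists_coordinates hX hr i₁
  obtain ⟨ρ, J, hρ, hYρ, hJ, hdet⟩ :
      ∃ (ρ : Fin n → Fin n) (J : Fin n → Fin (s + 1) → Fin n), (∀ i, ρ (ρ i) = ρ i) ∧
        (∀ i, Y i = Y (ρ i) ∨ Y i = -Y (ρ i)) ∧
        (∀ i, ρ i = i → ∀ l, G.Adj i (J i l)) ∧ ∀ i, ρ i = i → (frame J Y i).det ≠ 0 := by
    rcases h with ⟨rfl, hG⟩ | ⟨-, hG⟩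
    -- The rank `s + 2` is at most `d = 2`.
    · obtain rfl : s = 0 := by omega
      exact exists_type_of_stronglyConnected hG hunit hspan
    · exact exists_type_of_isComplete hG hunit hspan
  simp only [Set.mem_iUnion]
  exact ⟨s, ρ, J, hρ, hJ, Y, hunit, hY₁, hYρ, hdet, hc⟩

end Union

end SphereConsensus

theorem theorem3 (n d : ℕ) (hn : 1 ≤ n) (G : Digraph (Fin n))
    (h : (d = 2 ∧ SphereConsensus.StronglyConnected G) ∨
      (2 ≤ d ∧ SphereConsensus.IsComplete G)) :
    SphereConsensus.IsNullInWeightMatrices G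
      {A | A ∈ SphereConsensus.weightMatrices G ∧
        SphereConsensus.fixedPts d A ≠ SphereConsensus.rankOneStates n d} := by
  refine ⟨fun A hA => hA.1, ?_⟩
  refine MeasureTheory.measure_mono_null
    (SphereConsensus.toMatrix_preimage_subset ⟨0, hn⟩ h) ?_
  simp only [MeasureTheory.measure_iUnion_null_iff]
  exact fun s ρ J hρ hJ => SphereConsensus.volume_fixedPt_type_eq_zero ρ J hρ hJ _
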